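/- Let $p$ be an odd prime, $\mathbf{F}$ a field of characteristic $p$, and $L=\bigoplus_{i\ge 1}L_i$ an infinite-dimensional graded Lie algebra of maximal class over $\mathbf{F}$; that is, $L$ is a graded Lie algebra generated by $L_1$, with $\dim L_1=2$ and $\dim L_i\le 1$ for all $i\ge 2$. For $m\ge 2$ let $C_m=C_{L_1}(L_m)=\{u\in L_1 : [v,u]=0 \text{ for all } v\in L_m\}$ be the two-step centralizers of $L$. List the distinct subspaces occurring in the sequence $C_2,C_3,\dots$ in order of their first occurrence; thus the $i$-th two-step centralizer ($i\ge 1$) is the $i$-th distinct subspace to appear in this sequence. If $L$ has an $i$-th two-step centralizer $D$, then $D$ appears for the first time as $C_{L_1}(L_{2p^n})$ for some integer $n\ge i-1$; that is, $D=C_{2p^n}$ and $D\ne C_j$ for all $2\le j<2p^n$. -/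

import Mathlib

/-- `L = ⨁_{i ≥ 1} 𝒜 i` is an algebra of maximal class: a graded Lie algebra, graded over the
positive integers (the component of index `0` is zero), generated by `𝒜 1`, with
`dim (𝒜 1) = 2` and `dim (𝒜 i) ≤ 1` for `i ≥ 2`. -/
structure IsAlgebraOfMaximalClass (F : Type*) {L : Type*} [Field F] [LieRing L] [LieAlgebra F L]
    (𝒜 : ℕ → Submodule F L) : Prop where
  isInternal : DirectSum.IsInternal 𝒜
  component_zero : 𝒜 0 = ⊥
  lie_mem : ∀ i j : ℕ, ∀ u ∈ 𝒜 i, ∀ v ∈ 𝒜 j, ⁅u, v⁆ ∈ 𝒜 (i + j)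
  rank_one : Module.rank F (𝒜 1) = 2
  rank_le_one : ∀ i : ℕ, 2 ≤ i → Module.rank F (𝒜 i) ≤ 1
  generated : LieSubalgebra.lieSpan F L (𝒜 1 : Set L) = ⊤

/-- The two-step centralizer `C_{L_1}(L_i)`: the elements of `𝒜 1` that commute with all of
`𝒜 i`. -/
def twoStepCentralizer {F L : Type*} [Field F] [LieRing L] [LieAlgebra F L]
    (𝒜 : ℕ → Submodule F L) (i : ℕ) : Submodule F L where
  carrier := {u | u ∈ 𝒜 1 ∧ ∀ v ∈ 𝒜 i, ⁅v, u⁆ = 0}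
  zero_mem' := ⟨Submodule.zero_mem _, fun v _ => lie_zero v⟩
  add_mem' := fun ha hb =>
    ⟨Submodule.add_mem _ ha.1 hb.1, fun v hv => by rw [lie_add, ha.2 v hv, hb.2 v hv, add_zero]⟩
  smul_mem' := fun c _ ha =>
    ⟨Submodule.smul_mem _ c ha.1, fun v hv => by rw [lie_smul, ha.2 v hv, smul_zero]⟩

/-- `D` appears for the first time, in the sequence `C_{L_1}(L_2), C_{L_1}(L_3), …` of two-step
centralizers, as `C_{L_1}(L_m)`. -/
def FirstOccursAt {F L : Type*} [Field F] [LieRing L] [LieAlgebra F L]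
    (𝒜 : ℕ → Submodule F L) (D : Submodule F L) (m : ℕ) : Prop :=
  2 ≤ m ∧ twoStepCentralizer 𝒜 m = D ∧
    ∀ j : ℕ, 2 ≤ j → j < m → twoStepCentralizer 𝒜 j ≠ D

/-- `D` is the `i`-th two-step centralizer in order of occurrence (counting from `i = 1`): when
`D` first occurs, in weight `m` say, exactly `i` distinct subspaces (the last one being `D`)
have appeared among `C_{L_1}(L_2), …, C_{L_1}(L_m)`. -/
def IsNthTwoStepCentralizer {F L : Type*} [Field F] [LieRing L] [LieAlgebra F L]
    (𝒜 : ℕ → Submodule F L) (i : ℕ) (D : Submodule F L) : Prop :=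
  ∃ m : ℕ, FirstOccursAt 𝒜 D m ∧ (twoStepCentralizer 𝒜 '' Set.Icc 2 m).ncard = i

/-! Let `x, y` be a basis of `L_1`, and extend scalars to `F(t)`. No two-step centralizer defined
over `F` contains `x + t y`, so bracketing with this element never kills a component. Rescaling then
gives a basis `v 1 = y, v 2, …` on which it acts as the shift, and everything is encoded in a
bracket table `c`. Two centralizers agree exactly when the corresponding entries of the first column
`c j 1` do. The distinct values there are `0` or `1 / (t - r)`, hence affinely independent over `F`;
additive functionals can therefore single out one value at a time.

Translating `y` by a multiple of the shift element makes `c 2 1 = 0`. For a new value first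
occurring in row `m > 2`, the functional isolating it leaves a skew table with the Leibniz rule, and
this forces `2 * p ∣ m`. The Jacobi identity then puts nonzero entries at least `p` rows apart.

The `p`-th power of the shift is again a derivation, so the `v (p * i)` give a deflated table. Its
first column sums the original one over blocks of `p` rows, each with at most one nonzero entry: no
nonzero value is lost, and a first occurrence in row `p * k` becomes one in row `k`. Induction gives
`m = 2 * p ^ n`. Each deflation loses at most the value `0`, so at most `n + 1` values occur up to
row `m`. -/

/-- The structure constants `⁅v i, v j⁆ = c i j • v (i + j)`, `1 ≤ i, j`, of a graded Lie algebra
with basis `v 1, v 2, …` on which the shift `v i ↦ v (i + 1)` is a derivation. -/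
structure IsBracketTable {K : Type*} [Field K] (c : ℕ → ℕ → K) : Prop where
  skew : ∀ i j, 1 ≤ i → 1 ≤ j → c i j = -c j i
  leibniz : ∀ i j, 1 ≤ i → 1 ≤ j → c i j = c (i + 1) j + c i (j + 1)
  jacobi : ∀ i j k, 1 ≤ i → 1 ≤ j → 1 ≤ k →
    c i j * c (i + j) k + c j k * c (j + k) i + c k i * c (k + i) j = 0

/-- The values `c j 1`, `2 ≤ j`, are affinely independent over the prime field: the indicator
function of each of them is the restriction of an additive map plus a constant. -/
def IsSeparated {K : Type*} [Field K] (c : ℕ → ℕ → K) : Prop :=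
  ∀ m, 2 ≤ m → ∃ (φ : K →+ K) (a : K), ∀ j, 2 ≤ j →
    (c j 1 = c m 1 → φ (c j 1) = a + 1) ∧ (c j 1 ≠ c m 1 → φ (c j 1) = a)

/-! ### Consequences of skew-symmetry and the Leibniz rule -/

section Leibniz

variable {K : Type*} [Field K] {g : ℕ → ℕ → K}

/-- In a table satisfying the Leibniz rule, `g (i + ·) j` determines `g i (j + n)`. -/
theorem apply_add_eq_sum_of_leibniz
    (hg : ∀ i j, 1 ≤ i → 1 ≤ j → g i j = g (i + 1) j + g i (j + 1))
    (n : ℕ) : ∀ i j, 1 ≤ i → 1 ≤ j →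
      g i (j + n) = ∑ k ∈ Finset.range (n + 1), (-1) ^ k * (n.choose k : K) * g (i + k) j := by
  induction n with
  | zero => intro i j _ _; simp
  | succ n ih =>
    intro i j hi hj
    have h := hg i (j + n) hi (by omega)
    rw [ih i j hi hj, ih (i + 1) j (by omega) hj] at h
    rw [← add_assoc, ← sub_eq_iff_eq_add'.mpr h, Finset.sum_range_succ' _ (n + 1)]
    rw [Finset.sum_range_succ' _ n]
    simp only [Nat.choose_succ_succ, Nat.cast_add, mul_add, add_mul, Finset.sum_add_distrib]
    have e : ∑ k ∈ Finset.range (n + 1), (-1 : K) ^ (k + 1) * (n.choose (k + 1) : K) * g (i + (k + 1)) j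
        = ∑ k ∈ Finset.range n, (-1 : K) ^ (k + 1) * (n.choose (k + 1) : K) * g (i + (k + 1)) j := by
      rw [Finset.sum_range_succ]; simp
    have e2 : ∑ k ∈ Finset.range (n + 1), (-1 : K) ^ (k + 1) * (n.choose k : K) * g (i + (k + 1)) j
        = - ∑ k ∈ Finset.range (n + 1), (-1 : K) ^ k * (n.choose k : K) * g (i + 1 + k) j := by
      rw [← Finset.sum_neg_distrib]
      refine Finset.sum_congr rfl fun k _ => ?_
      rw [show i + 1 + k = i + (k + 1) by ring]; ring
    rw [e, e2]
    simp
    ring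

/-- The `p`-th power of a derivation is a derivation in characteristic `p`. -/
theorem leibniz_prime_shift {p : ℕ} (hp : p.Prime) (hodd : p ≠ 2) [CharP K p]
    (hg : ∀ i j, 1 ≤ i → 1 ≤ j → g i j = g (i + 1) j + g i (j + 1))
    (i j : ℕ) (hi : 1 ≤ i) (hj : 1 ≤ j) : g i j = g (i + p) j + g i (j + p) := by
  have h := apply_add_eq_sum_of_leibniz hg p i j hi hj
  rw [Finset.sum_range_succ, Finset.sum_eq_single_of_mem 0 (by simp [hp.pos])] at h
  · rw [h, (hp.odd_of_ne_two hodd).neg_one_pow]; simp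
  · intro k hk hk0
    have : (p.choose k : K) = 0 := by
      rw [CharP.cast_eq_zero_iff K p]
      exact hp.dvd_choose_self hk0 (Finset.mem_range.mp hk)
    simp [this]

theorem neg_one_pow_mul_choose_prime_sub_one {p : ℕ} (hp : p.Prime) [CharP K p] :
    ∀ k, k < p → (-1 : K) ^ k * ((p - 1).choose k : K) = 1 := by
  intro k
  induction k with
  | zero => simp
  | succ k ih =>
    intro hk
    have h0 : (p.choose (k + 1) : K) = 0 := by
      rw [CharP.cast_eq_zero_iff K p]
      exact hp.dvd_choose_self (by omega) hk
    obtain ⟨q, rfl⟩ : ∃ q, p = q + 1 := ⟨p - 1, by have := hp.pos; omega⟩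
    have h1 := ih (by omega)
    rw [Nat.choose_succ_succ, Nat.cast_add] at h0
    simp only [Nat.add_sub_cancel] at h1 ⊢
    rw [pow_succ]
    linear_combination h1 - (-1 : K) ^ k * h0

/-- Going from column `1` to column `p` takes `p - 1` steps, and the signed binomial coefficients of
`p - 1` are all `1` modulo `p`. -/
theorem apply_prime_eq_sum {p : ℕ} (hp : p.Prime) [CharP K p]
    (hg : ∀ i j, 1 ≤ i → 1 ≤ j → g i j = g (i + 1) j + g i (j + 1))
    (i : ℕ) (hi : 1 ≤ i) : g i p = ∑ k ∈ Finset.range p, g (i + k) 1 := by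
  have h := apply_add_eq_sum_of_leibniz hg (p - 1) i 1 hi le_rfl
  have hp1 : p - 1 + 1 = p := by have := hp.pos; omega
  rw [add_comm 1, hp1] at h
  rw [h]
  refine Finset.sum_congr rfl fun k hk => ?_
  rw [neg_one_pow_mul_choose_prime_sub_one hp k (Finset.mem_range.mp hk), one_mul]

/-- A skew table satisfying the Leibniz rule whose first column vanishes up to an isolated
nonzero entry in row `m`: then `m` is divisible by `2 * p`. -/
theorem two_mul_prime_dvd_of_first_ne_zero {p : ℕ} (hp : p.Prime) (hodd : p ≠ 2) [CharP K p]
    (hskew : ∀ i j, 1 ≤ i → 1 ≤ j → g i j = -g j i)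
    (hg : ∀ i j, 1 ≤ i → 1 ≤ j → g i j = g (i + 1) j + g i (j + 1))
    {m : ℕ} (hm : 1 ≤ m) (hlt : ∀ i, 1 ≤ i → i < m → g i 1 = 0) (hne : g m 1 ≠ 0)
    (hsucc : g (m + 1) 1 = 0) : 2 * p ∣ m := by
  have h2 : (2 : K) ≠ 0 := by
    have : ((2 : ℕ) : K) ≠ 0 := by
      rw [Ne, CharP.cast_eq_zero_iff K p, Nat.dvd_prime Nat.prime_two]
      exact fun h => h.elim hp.ne_one hodd
    exact_mod_cast this
  have hg' : ∀ i j, 1 ≤ i → 1 ≤ j → g i (j + 1) = g i j - g (i + 1) j := fun i j hi hj => by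
    rw [hg i j hi hj]; ring
  -- The Leibniz rule is solved along antidiagonals: zero up to index sum `m`, alternating multiples
  -- of `g m 1` at `m + 1`, and a factor linear in `j` at `m + 2`.
  have h0 : ∀ j i, 1 ≤ i → i + (j + 1) ≤ m → g i (j + 1) = 0 := by
    intro j
    induction j with
    | zero => exact fun i hi h => hlt i hi (by omega)
    | succ j ih =>
      intro i hi h
      rw [hg' i (j + 1) hi (by omega), ih i hi (by omega), ih (i + 1) (by omega) (by omega), sub_zero]
  have h1 : ∀ j i, 1 ≤ i → i + j = m → g i (j + 1) = (-1) ^ j * g m 1 := by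
    intro j
    induction j with
    | zero => intro i hi h; simp at h; simp [h]
    | succ j ih =>
      intro i hi h
      rw [hg' i (j + 1) hi (by omega), h0 j i hi (by omega), ih (i + 1) (by omega) (by omega)]
      ring
  have h3 : ∀ j i, 1 ≤ i → i + j = m + 1 → g i (j + 1) = -(-1) ^ j * j * g m 1 := by
    intro j
    induction j with
    | zero => intro i hi h; simp at h; simp [h, hsucc]
    | succ j ih =>
      intro i hi h
      rw [hg' i (j + 1) hi (by omega), h1 j i hi (by omega), ih (i + 1) (by omega) (by omega)]
      push_cast; ring
  -- For odd `m`, the entries `(1, m)` and `(m, 1)` would be equal as well as opposite.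
  have heven : Even m := by
    by_contra hodd'
    obtain ⟨k, rfl⟩ := Nat.not_even_iff_odd.mp hodd'
    have e1 := h1 (2 * k) 1 le_rfl (by omega)
    rw [hskew _ _ le_rfl (by omega)] at e1
    simp only [pow_mul, neg_one_sq, one_pow, one_mul] at e1
    apply hne
    have : 2 * g (2 * k + 1) 1 = 0 := by linear_combination -e1
    simpa [h2] using this
  obtain ⟨k, rfl⟩ := heven.two_dvd
  -- With `m = 2 * k`, the diagonal entry `(k + 1, k + 1)` is `± k * g m 1`; it vanishes by
  -- skew-symmetry, so `p ∣ k`.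
  have e2 := h3 k (k + 1) (by omega) (by omega)
  have e3 : g (k + 1) (k + 1) = 0 := by
    have := hskew (k + 1) (k + 1) (by omega) (by omega)
    have : 2 * g (k + 1) (k + 1) = 0 := by linear_combination this
    simpa [h2] using this
  rw [e3] at e2
  have : (k : K) = 0 := by simpa [hne] using e2.symm
  exact mul_dvd_mul_left 2 ((CharP.cast_eq_zero_iff K p k).mp this)

end Leibniz

/-! ### Translation, deflation and the induction on first occurrences -/

namespace IsBracketTable

variable {K : Type*} [Field K] {c : ℕ → ℕ → K}

/-- Replacing `v 1 = y` by `y - s • x`, where `x` is the element inducing the shift. -/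
def translate (c : ℕ → ℕ → K) (s : K) (i j : ℕ) : K :=
  c i j - s * ((if j = 1 then 1 else 0) - (if i = 1 then 1 else 0))

theorem translate_apply_one (c : ℕ → ℕ → K) (s : K) {j : ℕ} (hj : 2 ≤ j) :
    translate c s j 1 = c j 1 - s := by
  have : j ≠ 1 := by omega
  simp [translate, this]

theorem isBracketTable_translate (hc : IsBracketTable c) (s : K) :
    IsBracketTable (translate c s) where
  skew i j hi hj := by
    simp only [translate]; rw [hc.skew i j hi hj]; ring
  leibniz i j hi hj := by
    have e1 : i + 1 ≠ 1 := by omega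
    have e2 : j + 1 ≠ 1 := by omega
    simp only [translate, e1, e2, if_false]; rw [hc.leibniz i j hi hj]; ring
  jacobi i j k hi hj hk := by
    have e1 : i + j ≠ 1 := by omega
    have e2 : j + k ≠ 1 := by omega
    have e3 : k + i ≠ 1 := by omega
    -- In the translated Jacobi sum the terms quadratic in `s` cancel cyclically; the linear ones
    -- group into three expressions of this shape.
    have aux : ∀ i j k, 1 ≤ i → 1 ≤ j → 1 ≤ k →
        (if i = 1 then (1 : K) else 0) * (c j k - c (i + j) k + c (k + i) j) = 0 := by
      intro i j k hi hj hk
      split_ifs with h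
      · subst h
        rw [add_comm 1 j, hc.leibniz j k hj hk, hc.skew (k + 1) j (by omega) hj]; ring
      · ring
    have h1 := aux i j k hi hj hk
    have h2 := aux j k i hj hk hi
    have h3 := aux k i j hk hi hj
    simp only [translate, e1, e2, e3, if_false]
    linear_combination hc.jacobi i j k hi hj hk - s * h1 - s * h2 - s * h3

theorem isSeparated_translate (hs : IsSeparated c) (s : K) : IsSeparated (translate c s) := by
  intro m hm
  obtain ⟨φ, a, h⟩ := hs m hm
  refine ⟨φ, a - φ s, fun j hj => ?_⟩
  rw [translate_apply_one c s hj, translate_apply_one c s hm, sub_left_inj, map_sub]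
  exact ⟨fun e => by rw [(h j hj).1 e]; ring, fun e => by rw [(h j hj).2 fun e' => e (by rw [e'])]⟩

/-- The structure constants of the deflation, the span of the `v (p * i)`, whose shift is the
`p`-th power of the original one. -/
theorem deflate {p : ℕ} (hp : p.Prime) (hodd : p ≠ 2) [CharP K p] (hc : IsBracketTable c) :
    IsBracketTable fun i j => c (p * i) (p * j) where
  skew i j hi hj := hc.skew _ _ (Nat.mul_pos hp.pos hi) (Nat.mul_pos hp.pos hj)
  leibniz i j hi hj :=
    leibniz_prime_shift hp hodd hc.leibniz _ _ (Nat.mul_pos hp.pos hi) (Nat.mul_pos hp.pos hj)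
  jacobi i j k hi hj hk := by
    simp only [mul_add]
    exact hc.jacobi _ _ _ (Nat.mul_pos hp.pos hi) (Nat.mul_pos hp.pos hj) (Nat.mul_pos hp.pos hk)

/-- If `c 2 1 = 0`, then nonzero entries in the first column are isolated. -/
theorem apply_one_succ_eq_zero (hc : IsBracketTable c) (h : c 2 1 = 0) :
    ∀ i, 1 ≤ i → c i 1 ≠ 0 → c (i + 1) 1 = 0 := by
  intro i hi
  induction i, hi using Nat.le_induction with
  | base => exact fun _ => h
  | succ i hi ih =>
    intro hne
    by_contra hne'
    have h0 : c i 1 = 0 := by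
      by_contra h0
      exact hne (ih h0)
    have e1 := hc.leibniz i 1 hi le_rfl
    have e2 := hc.leibniz (i + 1) 1 (by omega) le_rfl
    -- As `c 2 1` and `c i 1` vanish, only `c i 2 * c (i + 2) 1 = 0` survives, where `c i 2 = -c (i
    -- + 1) 1`.
    have e3 := hc.jacobi i 2 1 hi (by omega) le_rfl
    rw [h, hc.skew 1 i le_rfl hi, h0] at e3
    rw [h0] at e1
    have e4 : c i 2 = - c (i + 1) 1 := by linear_combination -e1
    rw [e4] at e3
    simp [hne] at e3
    exact hne' e3

variable {p : ℕ}

theorem apply_one_one_eq_zero (hp : p.Prime) (hodd : p ≠ 2) [CharP K p] (hc : IsBracketTable c) :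
    c 1 1 = 0 := by
  have h2 : (2 : K) ≠ 0 := by
    have : ((2 : ℕ) : K) ≠ 0 := by
      rw [Ne, CharP.cast_eq_zero_iff K p, Nat.dvd_prime Nat.prime_two]
      exact fun h => h.elim hp.ne_one hodd
    exact_mod_cast this
  have : 2 * c 1 1 = 0 := by linear_combination hc.skew 1 1 le_rfl le_rfl
  simpa [h2] using this

/-- A nonzero value in the first column first occurs in a row divisible by `2 * p`. -/
theorem two_mul_prime_dvd_of_first_occurrence (hp : p.Prime) (hodd : p ≠ 2) [CharP K p]
    (hc : IsBracketTable c) (hs : IsSeparated c) (h : c 2 1 = 0) {m : ℕ} (hm : 2 ≤ m)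
    (hne : c m 1 ≠ 0) (hfirst : ∀ j, 2 ≤ j → j < m → c j 1 ≠ c m 1) : 2 * p ∣ m := by
  obtain ⟨φ, a, hφ⟩ := hs m hm
  have ha : a = 0 := by
    have := (hφ 2 le_rfl).2 (by rw [h]; exact hne.symm)
    rw [h, map_zero] at this
    exact this.symm
  subst ha
  -- Skewness and the Leibniz rule are additive in the table, so they survive `φ`, which kills every
  -- first-column value other than `c m 1`.
  refine two_mul_prime_dvd_of_first_ne_zero (g := fun i j => φ (c i j)) hp hodd
    (fun i j hi hj => by rw [hc.skew i j hi hj, map_neg])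
    (fun i j hi hj => by rw [hc.leibniz i j hi hj, map_add]) (by omega) ?_ ?_ ?_
  · intro i hi him
    rcases Nat.lt_or_ge i 2 with h2 | h2
    · obtain rfl : i = 1 := by omega
      rw [hc.apply_one_one_eq_zero hp hodd, map_zero]
    · exact (hφ i h2).2 (hfirst i h2 him)
  · rw [(hφ m hm).1 rfl]; simp
  · rw [hc.apply_one_succ_eq_zero h m (by omega) hne, map_zero]

theorem apply_one_eq_zero_of_lt (hp : p.Prime) (hodd : p ≠ 2) [CharP K p]
    (hc : IsBracketTable c) (hs : IsSeparated c) (h : c 2 1 = 0) :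
    ∀ j, 1 ≤ j → j < 2 * p → c j 1 = 0 := by
  intro j
  induction j using Nat.strong_induction_on with
  | _ j ih =>
    intro hj hjp
    by_contra hne
    have h2 : 2 ≤ j := by
      by_contra h2
      obtain rfl : j = 1 := by omega
      exact hne (hc.apply_one_one_eq_zero hp hodd)
    have := Nat.le_of_dvd hj (hc.two_mul_prime_dvd_of_first_occurrence hp hodd hs h h2 hne
      fun i hi hij => by rw [ih i hij (by omega) (by omega)]; exact Ne.symm hne)
    omega

/-- Nonzero entries in the first column are at least `p` rows apart. -/
theorem apply_one_add_eq_zero (hp : p.Prime) (hodd : p ≠ 2) [CharP K p]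
    (hc : IsBracketTable c) (hs : IsSeparated c) (h : c 2 1 = 0) {i : ℕ} (hi : 1 ≤ i)
    (hne : c i 1 ≠ 0) : ∀ d, 0 < d → d < p → c (i + d) 1 = 0 := by
  intro d
  induction d using Nat.strong_induction_on with
  | _ d ih =>
    intro hd hdp
    by_contra hne'
    have hsucc := hc.apply_one_succ_eq_zero h (i + d) (by omega) hne'
    -- All that remains of this identity is `c 1 i * c (i + 1) (d + 1) = 0`, and the expansion of
    -- the second factor reduces to `± d * c (i + d) 1`.
    have hj := hc.jacobi i (d + 1) 1 hi (by omega) le_rfl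
    rw [hc.apply_one_eq_zero_of_lt hp hodd hs h (d + 1) (by omega) (by omega), ← add_assoc, hsucc,
      hc.skew 1 i le_rfl hi, add_comm 1 i, add_comm d 1,
      apply_add_eq_sum_of_leibniz hc.leibniz d (i + 1) 1 (by omega) le_rfl,
      Finset.sum_eq_single_of_mem (d - 1) (Finset.mem_range.mpr (by omega))] at hj
    · rw [show i + 1 + (d - 1) = i + d by omega] at hj
      have hch : d.choose (d - 1) = d := by
        conv_lhs => rw [Nat.choose_symm (by omega : 1 ≤ d)]
        exact Nat.choose_one_right d
      rw [hch] at hj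
      have hd0 : (d : K) = 0 := by simpa [hne, hne'] using hj
      exact absurd (Nat.le_of_dvd hd ((CharP.cast_eq_zero_iff K p d).mp hd0)) (by omega)
    · intro k hk hkd
      rw [Finset.mem_range] at hk
      rcases Nat.lt_or_ge k d with h1 | h1
      · rw [show i + 1 + k = i + (k + 1) by omega, ih (k + 1) (by omega) (by omega) (by omega),
          mul_zero]
      · rw [show i + 1 + k = i + d + 1 by omega, hsucc, mul_zero]

/-- The first column of the deflation, at the block of a nonzero entry. -/
theorem deflate_apply_of_ne_zero (hp : p.Prime) (hodd : p ≠ 2) [CharP K p]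
    (hc : IsBracketTable c) (hs : IsSeparated c) (h : c 2 1 = 0) {l : ℕ} (hl : 2 ≤ l / p)
    (hne : c l 1 ≠ 0) : c (p * (l / p)) p = c l 1 := by
  have hpos : 1 ≤ p * (l / p) := Nat.mul_pos hp.pos (by omega)
  have hdiv := Nat.div_add_mod l p
  have hmod := Nat.mod_lt l hp.pos
  rw [apply_prime_eq_sum hp hc.leibniz _ hpos,
    Finset.sum_eq_single_of_mem (l % p) (Finset.mem_range.mpr hmod), hdiv]
  intro r hr hrne
  rw [Finset.mem_range] at hr
  by_contra hr0
  rcases Nat.lt_or_ge r (l % p) with hlt | hge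
  · apply hne
    rw [← hc.apply_one_add_eq_zero hp hodd hs h (by omega) hr0 (l % p - r) (by omega) (by omega)]
    congr 1; omega
  · apply hr0
    rw [← hc.apply_one_add_eq_zero hp hodd hs h (by omega) hne (r - l % p) (by omega) (by omega)]
    congr 1; omega

theorem deflate_apply_eq (hp : p.Prime) (hodd : p ≠ 2) [CharP K p]
    (hc : IsBracketTable c) (hs : IsSeparated c) (h : c 2 1 = 0) {k : ℕ} (hk : 2 ≤ k) :
    c (p * k) p = 0 ∨ ∃ l, l / p = k ∧ c (p * k) p = c l 1 := by
  by_cases h0 : ∃ r < p, c (p * k + r) 1 ≠ 0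
  · obtain ⟨r, hr, hne⟩ := h0
    have hq : (p * k + r) / p = k := by
      rw [Nat.mul_add_div hp.pos, Nat.div_eq_of_lt hr, add_zero]
    refine Or.inr ⟨p * k + r, hq, ?_⟩
    have := hc.deflate_apply_of_ne_zero hp hodd hs h (by rw [hq]; exact hk) hne
    rwa [hq] at this
  · push Not at h0
    left
    rw [apply_prime_eq_sum hp hc.leibniz _ (Nat.mul_pos hp.pos (by omega))]
    exact Finset.sum_eq_zero fun r hr => h0 r (Finset.mem_range.mp hr)

theorem isSeparated_deflate (hp : p.Prime) (hodd : p ≠ 2) [CharP K p]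
    (hc : IsBracketTable c) (hs : IsSeparated c) (h : c 2 1 = 0) :
    IsSeparated fun i j => c (p * i) (p * j) := by
  have key : ∀ k, 2 ≤ k → ∃ l, 2 ≤ l ∧ c (p * k) p = c l 1 := by
    intro k hk
    rcases hc.deflate_apply_eq hp hodd hs h hk with h0 | ⟨l, hl, e⟩
    · exact ⟨2, le_rfl, by rw [h0, h]⟩
    · exact ⟨l, (hl ▸ hk).trans (Nat.div_le_self l p), e⟩
  intro m hm
  obtain ⟨l, hl, e⟩ := key m hm
  obtain ⟨φ, a, hφ⟩ := hs l hl
  refine ⟨φ, a, fun j hj => ?_⟩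
  obtain ⟨l', hl', e'⟩ := key j hj
  simp only [mul_one]
  rw [e, e']
  exact hφ l' hl'

/-- Every value in the first column (from the second row on) first occurs in a row `2 * p ^ n`,
and at most `n + 1` values occur up to there. -/
theorem exists_eq_two_mul_prime_pow (hp : p.Prime) (hodd : p ≠ 2) [CharP K p] (m : ℕ) :
    ∀ c : ℕ → ℕ → K, IsBracketTable c → IsSeparated c → 2 ≤ m →
      (∀ j, 2 ≤ j → j < m → c j 1 ≠ c m 1) →
      ∃ n, m = 2 * p ^ n ∧ ((fun j => c j 1) '' Set.Icc 2 m).ncard ≤ n + 1 := by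
  induction m using Nat.strong_induction_on with
  | _ m ih =>
    -- The deflation of a table with `c 2 1 = 0` need not have this property, so the induction runs
    -- over all tables and normalizes each time.
    suffices H : ∀ c : ℕ → ℕ → K, IsBracketTable c → IsSeparated c → c 2 1 = 0 → 2 ≤ m →
        (∀ j, 2 ≤ j → j < m → c j 1 ≠ c m 1) →
        ∃ n, m = 2 * p ^ n ∧ ((fun j => c j 1) '' Set.Icc 2 m).ncard ≤ n + 1 by
      intro c hc hs hm hfirst
      obtain ⟨n, hn, hcard⟩ := H _ (hc.isBracketTable_translate (c 2 1))
        (isSeparated_translate hs (c 2 1)) (by rw [translate_apply_one _ _ le_rfl, sub_self]) hm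
        (fun j hj hjm e => hfirst j hj hjm (by
          rwa [translate_apply_one _ _ hj, translate_apply_one _ _ hm, sub_left_inj] at e))
      refine ⟨n, hn, ?_⟩
      rw [← Set.ncard_image_of_injective _ (sub_left_injective (b := c 2 1)), Set.image_image]
      rwa [Set.image_congr fun j hj => translate_apply_one c (c 2 1) hj.1] at hcard
    intro c hc hs h hm hfirst
    rcases hm.eq_or_lt with rfl | hlt
    · exact ⟨0, by simp, by simp⟩
    have hne : c m 1 ≠ 0 := fun h0 => hfirst 2 le_rfl hlt (by rw [h, h0])
    have hdvd := hc.two_mul_prime_dvd_of_first_occurrence hp hodd hs h hm hne hfirst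
    obtain ⟨k, rfl⟩ : p ∣ m := (Dvd.intro_left 2 rfl).trans hdvd
    have hp2 := hp.two_le
    have hdiv : p * k / p = k := Nat.mul_div_cancel_left k hp.pos
    have hk : 2 ≤ k := by
      have h1 := Nat.le_of_dvd (by omega) hdvd
      rw [mul_comm] at h1
      exact Nat.le_of_mul_le_mul_left h1 hp.pos
    have hck : c (p * k) p = c (p * k) 1 := by
      have := hc.deflate_apply_of_ne_zero hp hodd hs h (by rw [hdiv]; exact hk) hne
      rwa [hdiv] at this
    -- As row `p * k` begins its block, all rows of earlier blocks precede it; an earlier occurrence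
    -- in the deflation would give one in `c`.
    obtain ⟨n, hn, hcard⟩ := ih k (by nlinarith) _ (hc.deflate hp hodd)
      (hc.isSeparated_deflate hp hodd hs h) hk (by
        intro j hj hjk
        simp only [mul_one]
        rw [hck]
        rcases hc.deflate_apply_eq hp hodd hs h hj with h0 | ⟨l, hl, e⟩
        · rw [h0]; exact hne.symm
        · rw [e]
          refine hfirst l ((hl ▸ hj).trans (Nat.div_le_self l p)) ?_
          rw [mul_comm]
          exact (Nat.div_lt_iff_lt_mul hp.pos).mp (hl ▸ hjk))
    refine ⟨n + 1, by rw [hn]; ring, ?_⟩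
    simp only [mul_one] at hcard
    have hsub : (fun j => c j 1) '' Set.Icc 2 (p * k) ⊆
        insert 0 ((fun j => c (p * j) p) '' Set.Icc 2 k) := by
      rintro _ ⟨l, ⟨hl0, hl⟩, rfl⟩
      by_cases h0 : c l 1 = 0
      · exact Or.inl h0
      have hl1 : 2 * p ≤ l := by
        by_contra hlt
        exact h0 (hc.apply_one_eq_zero_of_lt hp hodd hs h l (by omega) (by omega))
      have hl2 : 2 ≤ l / p := (Nat.le_div_iff_mul_le hp.pos).mpr hl1
      refine Or.inr ⟨l / p, ⟨hl2, ?_⟩, hc.deflate_apply_of_ne_zero hp hodd hs h hl2 h0⟩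
      rw [← hdiv]
      exact Nat.div_le_div_right hl
    exact (Set.ncard_le_ncard hsub (((Set.finite_Icc 2 k).image _).insert 0)).trans
      ((Set.ncard_insert_le _ _).trans (by omega))

end IsBracketTable

/-! ### The table over `F(t)` of a generic element of degree one -/

section GenericTable

variable {F : Type*} [Field F] (a b : ℕ → F) (e : ℕ → ℕ → F)

/-- The factor by which the bracket with `x + t • y`, `t` an indeterminate, acts in degree `i`,
where `x` and `y` act by `a i` and `b i`. -/
noncomputable def genericFactor (i : ℕ) : RatFunc F :=
  algebraMap F (RatFunc F) (a i) + RatFunc.X * algebraMap F (RatFunc F) (b i)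

/-- Structure constants with respect to a basis adapted to the bracket with `x + t • y`. -/
noncomputable def genericTable (i j : ℕ) : RatFunc F :=
  (∏ k ∈ Finset.Ico 1 i, genericFactor a b k) * (∏ k ∈ Finset.Ico 1 j, genericFactor a b k) *
    algebraMap F (RatFunc F) (e i j) / ∏ k ∈ Finset.Ico 1 (i + j), genericFactor a b k

variable {a b e}

theorem genericFactor_ne_zero {i : ℕ} (h : a i ≠ 0 ∨ b i ≠ 0) : genericFactor a b i ≠ 0 := by
  intro h0
  by_cases hb : b i = 0
  · rw [genericFactor, hb, map_zero, mul_zero, add_zero, map_eq_zero] at h0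
    exact h.elim (fun h => h h0) fun h => h hb
  · refine (RatFunc.transcendental_X (K := F)) ?_
    have hb' : algebraMap F (RatFunc F) (b i) ≠ 0 := by simpa using hb
    have hX : (RatFunc.X : RatFunc F) = algebraMap F (RatFunc F) (-a i / b i) := by
      rw [map_div₀, map_neg, eq_div_iff hb']
      rw [genericFactor] at h0
      linear_combination h0
    rw [hX]
    exact isAlgebraic_algebraMap _

theorem isBracketTable_genericTable
    (hskew : ∀ i j, 1 ≤ i → 1 ≤ j → e i j = -e j i)
    (hx : ∀ i j, 1 ≤ i → 1 ≤ j → e i j * a (i + j) = a i * e (i + 1) j + a j * e i (j + 1))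
    (hy : ∀ i j, 1 ≤ i → 1 ≤ j → e i j * b (i + j) = b i * e (i + 1) j + b j * e i (j + 1))
    (hjac : ∀ i j k, 1 ≤ i → 1 ≤ j → 1 ≤ k →
      e i j * e (i + j) k + e j k * e (j + k) i + e k i * e (k + i) j = 0)
    (hab : ∀ i, 1 ≤ i → a i ≠ 0 ∨ b i ≠ 0) : IsBracketTable (genericTable a b e) := by
  have hs : ∀ i, ∏ k ∈ Finset.Ico 1 i, genericFactor a b k ≠ 0 := fun i =>
    Finset.prod_ne_zero_iff.mpr fun k hk => genericFactor_ne_zero (hab k (Finset.mem_Ico.mp hk).1)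
  have hsucc : ∀ i, 1 ≤ i → ∏ k ∈ Finset.Ico 1 (i + 1), genericFactor a b k =
      (∏ k ∈ Finset.Ico 1 i, genericFactor a b k) * genericFactor a b i := fun i hi =>
    Finset.prod_Ico_succ_top hi _
  refine ⟨fun i j hi hj => ?_, fun i j hi hj => ?_, fun i j k hi hj hk => ?_⟩
  · rw [genericTable, genericTable, hskew i j hi hj, map_neg, add_comm j i]; ring
  · have hx' := congrArg (algebraMap F (RatFunc F)) (hx i j hi hj)
    have hy' := congrArg (algebraMap F (RatFunc F)) (hy i j hi hj)
    simp only [map_mul, map_add] at hx' hy'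
    simp only [genericTable]
    rw [show i + 1 + j = i + j + 1 by ring, ← add_assoc, hsucc i hi, hsucc j hj,
      hsucc (i + j) (by omega)]
    have hq := genericFactor_ne_zero (hab (i + j) (by omega))
    have h0 := hs (i + j)
    rw [← add_div, div_eq_div_iff h0 (mul_ne_zero h0 hq), genericFactor.eq_def a b i,
      genericFactor.eq_def a b j, genericFactor.eq_def a b (i + j)]
    linear_combination (∏ k ∈ Finset.Ico 1 i, genericFactor a b k) *
      (∏ k ∈ Finset.Ico 1 j, genericFactor a b k) *
      (∏ k ∈ Finset.Ico 1 (i + j), genericFactor a b k) * (hx' + RatFunc.X * hy')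
  · have hj' := congrArg (algebraMap F (RatFunc F)) (hjac i j k hi hj hk)
    simp only [map_mul, map_add, map_zero] at hj'
    simp only [genericTable]
    rw [show j + k + i = i + j + k by ring, show k + i + j = i + j + k by ring]
    have h1 := hs (i + j)
    have h2 := hs (j + k)
    have h3 := hs (k + i)
    have h4 := hs (i + j + k)
    generalize ∏ k ∈ Finset.Ico 1 (i + j), genericFactor a b k = s1 at *
    generalize ∏ l ∈ Finset.Ico 1 (j + k), genericFactor a b l = s2 at *
    generalize ∏ l ∈ Finset.Ico 1 (k + i), genericFactor a b l = s3 at *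
    generalize ∏ l ∈ Finset.Ico 1 (i + j + k), genericFactor a b l = s4 at *
    field_simp
    linear_combination (∏ l ∈ Finset.Ico 1 i, genericFactor a b l) *
      (∏ l ∈ Finset.Ico 1 j, genericFactor a b l) * (∏ l ∈ Finset.Ico 1 k, genericFactor a b l) * hj'

theorem genericTable_apply_one (h1 : ∀ i, 1 ≤ i → e i 1 = b i)
    (hab : ∀ i, 1 ≤ i → a i ≠ 0 ∨ b i ≠ 0) {i : ℕ} (hi : 1 ≤ i) :
    genericTable a b e i 1 = algebraMap F (RatFunc F) (b i) / genericFactor a b i := by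
  have hs : ∏ k ∈ Finset.Ico 1 i, genericFactor a b k ≠ 0 :=
    Finset.prod_ne_zero_iff.mpr fun k hk => genericFactor_ne_zero (hab k (Finset.mem_Ico.mp hk).1)
  rw [genericTable, Finset.prod_Ico_succ_top hi, h1 i hi]
  simp only [Finset.Ico_self, Finset.prod_empty, mul_one]
  rw [mul_div_mul_left _ _ hs]

theorem genericTable_apply_one_eq_iff (h1 : ∀ i, 1 ≤ i → e i 1 = b i)
    (hab : ∀ i, 1 ≤ i → a i ≠ 0 ∨ b i ≠ 0) {i j : ℕ} (hi : 1 ≤ i) (hj : 1 ≤ j) :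
    genericTable a b e i 1 = genericTable a b e j 1 ↔ b i * a j = b j * a i := by
  rw [genericTable_apply_one h1 hab hi, genericTable_apply_one h1 hab hj,
    div_eq_div_iff (genericFactor_ne_zero (hab i hi)) (genericFactor_ne_zero (hab j hj)),
    ← (algebraMap F (RatFunc F)).injective.eq_iff]
  simp only [genericFactor, map_mul]
  constructor
  · intro h; linear_combination h
  · intro h; linear_combination h

/-- The nonzero values are partial fractions `1 / (t - r)`, linearly independent over `F`, so a
linear functional can be prescribed on them freely. The possible value `0` is why constants are
allowed. -/
theorem isSeparated_genericTable (h1 : ∀ i, 1 ≤ i → e i 1 = b i)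
    (hab : ∀ i, 1 ≤ i → a i ≠ 0 ∨ b i ≠ 0) : IsSeparated (genericTable a b e) := by
  have hzero : ∀ i, 1 ≤ i → b i = 0 → genericTable a b e i 1 = 0 := fun i hi hb => by
    rw [genericTable_apply_one h1 hab hi, hb, map_zero, zero_div]
  have hinv : ∀ i, 1 ≤ i → b i ≠ 0 → genericTable a b e i 1 =
      (RatFunc.X - algebraMap F (RatFunc F) (-a i / b i))⁻¹ := fun i hi hb => by
    have hb' : algebraMap F (RatFunc F) (b i) ≠ 0 := by simpa using hb
    rw [genericTable_apply_one h1 hab hi, ← inv_div, genericFactor]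
    congr 1
    rw [map_div₀, map_neg]
    field_simp
    ring
  have hli := (RatFunc.transcendental_X (K := F)).linearIndependent_sub_inv
  have hext : ∀ g : F → F, ∃ ψ : RatFunc F →ₗ[F] F,
      ∀ r, ψ ((RatFunc.X - algebraMap F (RatFunc F) r)⁻¹) = g r := by
    intro g
    obtain ⟨ψ, hψ⟩ := LinearMap.exists_extend ((Module.Basis.span hli).constr F g)
    refine ⟨ψ, fun r => ?_⟩
    have h := LinearMap.congr_fun hψ (Module.Basis.span hli r)
    rw [Module.Basis.constr_basis] at h
    rw [← h, LinearMap.comp_apply, Submodule.subtype_apply, Module.Basis.span_apply]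
  intro m hm
  have hm1 : 1 ≤ m := by omega
  classical
  by_cases hb : b m = 0
  -- To isolate the value `0`, where `ψ` must vanish, all other values are sent to `-1`.
  · obtain ⟨ψ, hψ⟩ := hext fun _ => -1
    refine ⟨(algebraMap F (RatFunc F) : F →+ RatFunc F).comp (ψ : RatFunc F →+ F), -1,
      fun j hj => ?_⟩
    have hj1 : 1 ≤ j := by omega
    by_cases hbj : b j = 0
    · simp [hzero m hm1 hb, hzero j hj1 hbj]
    · have hne : genericTable a b e j 1 ≠ genericTable a b e m 1 := by
        rw [Ne, genericTable_apply_one_eq_iff h1 hab hj1 hm1, hb, zero_mul, mul_eq_zero, not_or]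
        exact ⟨hbj, (hab m hm1).resolve_right (not_not.mpr hb)⟩
      refine ⟨fun h => absurd h hne, fun _ => ?_⟩
      rw [hinv j hj1 hbj]
      simp only [AddMonoidHom.comp_apply, AddMonoidHom.coe_coe, hψ, map_neg, map_one]
  · obtain ⟨ψ, hψ⟩ := hext fun r => if r = -a m / b m then 1 else 0
    refine ⟨(algebraMap F (RatFunc F) : F →+ RatFunc F).comp (ψ : RatFunc F →+ F), 0,
      fun j hj => ?_⟩
    have hj1 : 1 ≤ j := by omega
    rw [ne_eq, genericTable_apply_one_eq_iff h1 hab hj1 hm1]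
    by_cases hbj : b j = 0
    · refine ⟨fun h => ?_, fun _ => by simp [hzero j hj1 hbj]⟩
      rw [hbj, zero_mul, eq_comm, mul_eq_zero] at h
      exact ((hab j hj1).elim (fun h' => h.elim hb h') fun h' => h' hbj).elim
    · rw [hinv j hj1 hbj]
      have hiff : b j * a m = b m * a j ↔ -a j / b j = -a m / b m := by
        rw [div_eq_div_iff hbj hb]
        constructor <;> intro h <;> linear_combination h
      rw [hiff]
      simp only [AddMonoidHom.comp_apply, AddMonoidHom.coe_coe, hψ]
      exact ⟨fun h => by simp [h], fun h => by simp [h]⟩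

end GenericTable

/-! ### From an algebra of maximal class to its bracket table -/

section MaximalClass

variable {F L : Type*} [Field F] [LieRing L] [LieAlgebra F L]

/-- The span of the left-normed products of `n + 1` elements of `V`. -/
def iteratedLieSpan (V : Submodule F L) : ℕ → Submodule F L
  | 0 => V
  | n + 1 => Submodule.span F {z | ∃ u ∈ iteratedLieSpan V n, ∃ w ∈ V, ⁅u, w⁆ = z}

theorem lie_mem_iteratedLieSpan (V : Submodule F L) (n : ℕ) :
    ∀ m, ∀ u ∈ iteratedLieSpan V m, ∀ v ∈ iteratedLieSpan V n,
      ⁅u, v⁆ ∈ iteratedLieSpan V (m + n + 1) := by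
  induction n with
  | zero => exact fun m u hu v hv => Submodule.subset_span ⟨u, hu, v, hv, rfl⟩
  | succ n ih =>
    intro m u hu v hv
    refine Submodule.span_induction ?_ ?_ ?_ ?_ hv
    · rintro _ ⟨v, hv, w, hw, rfl⟩
      have e : ⁅u, ⁅v, w⁆⁆ = ⁅⁅u, v⁆, w⁆ - ⁅⁅u, w⁆, v⁆ := by
        rw [leibniz_lie u v w, ← lie_skew ⁅u, w⁆ v]; abel
      rw [e]
      refine Submodule.sub_mem _ (Submodule.subset_span ⟨_, ih m u hu v hv, w, hw, rfl⟩) ?_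
      have := ih (m + 1) ⁅u, w⁆ (Submodule.subset_span ⟨u, hu, w, hw, rfl⟩) v hv
      rwa [show m + 1 + n + 1 = m + (n + 1) + 1 by ring] at this
    · rw [lie_zero]; exact Submodule.zero_mem _
    · intro x y _ _ hx hy; rw [lie_add]; exact Submodule.add_mem _ hx hy
    · intro r x _ hx; rw [lie_smul]; exact Submodule.smul_mem _ r hx

theorem iSup_iteratedLieSpan_eq_top {V : Submodule F L}
    (hV : LieSubalgebra.lieSpan F L (V : Set L) = ⊤) : ⨆ n, iteratedLieSpan V n = ⊤ := by
  let S : LieSubalgebra F L :=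
    { (⨆ n, iteratedLieSpan V n : Submodule F L) with
      lie_mem' := by
        intro u v hu hv
        change ⁅u, v⁆ ∈ ⨆ n, iteratedLieSpan V n
        refine Submodule.iSup_induction (iteratedLieSpan V)
          (motive := fun v => ⁅u, v⁆ ∈ ⨆ n, iteratedLieSpan V n) hv ?_ ?_ ?_
        · intro n v hv
          refine Submodule.iSup_induction (iteratedLieSpan V)
            (motive := fun u => ⁅u, v⁆ ∈ ⨆ n, iteratedLieSpan V n) hu ?_ ?_ ?_
          · exact fun m u hu => Submodule.mem_iSup_of_mem _ (lie_mem_iteratedLieSpan V n m u hu v hv)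
          · rw [zero_lie]; exact Submodule.zero_mem _
          · intro x y hx hy; rw [add_lie]; exact Submodule.add_mem _ hx hy
        · rw [lie_zero]; exact Submodule.zero_mem _
        · intro x y hx hy; rw [lie_add]; exact Submodule.add_mem _ hx hy }
  have hS : (⊤ : LieSubalgebra F L) ≤ S := by
    rw [← hV, LieSubalgebra.lieSpan_le]
    exact fun v hv => Submodule.mem_iSup_of_mem (p := iteratedLieSpan V) 0 hv
  exact eq_top_iff.mpr fun v _ => hS (LieSubalgebra.mem_top v)

namespace IsAlgebraOfMaximalClass

variable {𝒜 : ℕ → Submodule F L}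

/-- Left-normed products of elements of `𝒜 1` span `L` and respect the grading; independence of the
components turns the inclusions into equalities. -/
theorem iteratedLieSpan_eq (hL : IsAlgebraOfMaximalClass F 𝒜) (n : ℕ) :
    iteratedLieSpan (𝒜 1) n = 𝒜 (n + 1) := by
  have hle : ∀ n, iteratedLieSpan (𝒜 1) n ≤ 𝒜 (n + 1) := by
    intro n
    induction n with
    | zero => exact le_rfl
    | succ n ih =>
      refine Submodule.span_le.mpr ?_
      rintro _ ⟨u, hu, w, hw, rfl⟩
      exact hL.lie_mem _ _ u (ih hu) w hw
  refine le_antisymm (hle n) fun u hu => ?_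
  have htop : u ∈ iteratedLieSpan (𝒜 1) n ⊔ ⨆ k ≠ n + 1, 𝒜 k := by
    have h : (⊤ : Submodule F L) ≤ iteratedLieSpan (𝒜 1) n ⊔ ⨆ k ≠ n + 1, 𝒜 k := by
      rw [← iSup_iteratedLieSpan_eq_top hL.generated]
      refine iSup_le fun k => ?_
      by_cases hk : k = n
      · rw [hk]; exact le_sup_left
      · refine le_sup_of_le_right ((hle k).trans ?_)
        exact le_iSup₂_of_le (f := fun k (_ : k ≠ n + 1) => 𝒜 k) (k + 1) (by omega) le_rfl
    exact h Submodule.mem_top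
  obtain ⟨s, hs, t, ht, rfl⟩ := Submodule.mem_sup.mp htop
  have hdisj := hL.isInternal.submodule_iSupIndep (n + 1)
  have ht' : t ∈ 𝒜 (n + 1) := by
    have := Submodule.sub_mem _ hu (hle n hs)
    simpa using this
  have : t = 0 := Submodule.disjoint_def.mp hdisj t ht' ht
  rw [this, add_zero]
  exact hs

theorem component_succ_eq_span (hL : IsAlgebraOfMaximalClass F 𝒜) {i : ℕ} (hi : 1 ≤ i) :
    𝒜 (i + 1) = Submodule.span F {z | ∃ u ∈ 𝒜 i, ∃ w ∈ 𝒜 1, ⁅u, w⁆ = z} := by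
  obtain ⟨n, rfl⟩ : ∃ n, i = n + 1 := ⟨i - 1, by omega⟩
  rw [← hL.iteratedLieSpan_eq (n + 1), ← hL.iteratedLieSpan_eq n]
  rfl

theorem component_ne_bot (hL : IsAlgebraOfMaximalClass F 𝒜) (hinf : ¬ FiniteDimensional F L)
    {i : ℕ} (hi : 1 ≤ i) : 𝒜 i ≠ ⊥ := by
  intro hbot
  have hge : ∀ k, i ≤ k → 𝒜 k = ⊥ := by
    intro k hk
    induction k, hk using Nat.le_induction with
    | base => exact hbot
    | succ k hk ih =>
      rw [hL.component_succ_eq_span (hi.trans hk), eq_bot_iff, Submodule.span_le]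
      rintro _ ⟨u, hu, w, -, rfl⟩
      rw [ih, Submodule.mem_bot] at hu
      simp [hu]
  have hfin : ∀ k, Module.Finite F (𝒜 k) := by
    intro k
    rw [← Module.rank_lt_aleph0_iff]
    rcases Nat.lt_trichotomy k 1 with h | h | h
    · obtain rfl : k = 0 := by omega
      rw [hL.component_zero, rank_bot]
      exact Cardinal.aleph0_pos
    · rw [h, hL.rank_one]; exact_mod_cast Cardinal.natCast_lt_aleph0 (n := 2)
    · exact (hL.rank_le_one k h).trans_lt Cardinal.one_lt_aleph0
  apply hinf
  have htop : ⨆ k : Fin i, 𝒜 k = ⊤ := by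
    rw [eq_top_iff, ← hL.isInternal.submodule_iSup_eq_top]
    refine iSup_le fun k => ?_
    rcases Nat.lt_or_ge k i with h | h
    · exact le_iSup (fun k : Fin i => 𝒜 k) ⟨k, h⟩
    · rw [hge k h]; exact bot_le
  have : Module.Finite F (⨆ k : Fin i, 𝒜 k : Submodule F L) :=
    Submodule.finiteDimensional_iSup _
  rw [htop] at this
  exact Module.finite_def.mpr (Module.Finite.iff_fg.mp this)

theorem exists_generators (hL : IsAlgebraOfMaximalClass F 𝒜) :
    ∃ x ∈ 𝒜 1, ∃ y ∈ 𝒜 1, ∀ u ∈ 𝒜 1, ∃ r s : F, u = r • x + s • y := by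
  have : Module.Finite F (𝒜 1) := by
    rw [← Module.rank_lt_aleph0_iff, hL.rank_one]
    exact_mod_cast Cardinal.natCast_lt_aleph0 (n := 2)
  let B : Module.Basis (Fin 2) F (𝒜 1) :=
    Module.finBasisOfFinrankEq F (𝒜 1) (Module.finrank_eq_of_rank_eq (by exact_mod_cast hL.rank_one))
  refine ⟨B 0, (B 0).2, B 1, (B 1).2, fun u hu => ⟨B.repr ⟨u, hu⟩ 0, B.repr ⟨u, hu⟩ 1, ?_⟩⟩
  have h := congrArg Subtype.val (B.sum_repr ⟨u, hu⟩)
  rw [Fin.sum_univ_two] at h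
  exact h.symm

theorem exists_spanning_vector (hL : IsAlgebraOfMaximalClass F 𝒜)
    (hinf : ¬ FiniteDimensional F L) {i : ℕ} (hi : 2 ≤ i) :
    ∃ w ∈ 𝒜 i, w ≠ 0 ∧ ∀ u ∈ 𝒜 i, ∃ r : F, u = r • w := by
  obtain ⟨w, hw, hle⟩ := (rank_submodule_le_one_iff (𝒜 i)).mp (hL.rank_le_one i hi)
  refine ⟨w, hw, ?_, fun u hu => ?_⟩
  · rintro rfl
    apply hL.component_ne_bot hinf (i := i) (by omega)
    rw [eq_bot_iff]
    simpa using hle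
  · obtain ⟨r, hr⟩ := Submodule.mem_span_singleton.mp (hle hu)
    exact ⟨r, hr.symm⟩

/-- The two-step centralizers of an infinite-dimensional algebra of maximal class are encoded by
the first column of a bracket table over a field of rational functions. -/
theorem exists_bracketTable (hL : IsAlgebraOfMaximalClass F 𝒜) (hinf : ¬ FiniteDimensional F L) :
    ∃ c : ℕ → ℕ → RatFunc F, IsBracketTable c ∧ IsSeparated c ∧
      ∀ i j, 2 ≤ i → 2 ≤ j →
        (twoStepCentralizer 𝒜 i = twoStepCentralizer 𝒜 j ↔ c i 1 = c j 1) := by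
  obtain ⟨x, hx, y, hy, hxy⟩ := hL.exists_generators
  -- In degree one only `y` is kept: the other direction is used for the shift.
  have hw : ∀ i, ∃ w : L, (i = 1 → w = y) ∧ (1 ≤ i → w ∈ 𝒜 i) ∧
      (2 ≤ i → w ≠ 0 ∧ ∀ u ∈ 𝒜 i, ∃ r : F, u = r • w) := by
    intro i
    rcases Nat.lt_or_ge i 2 with h | h
    · refine ⟨if i = 1 then y else 0, fun h1 => by simp [h1], fun h1 => ?_, fun h' => by omega⟩
      obtain rfl : i = 1 := by omega
      simpa using hy
    · obtain ⟨w, hw, h0⟩ := hL.exists_spanning_vector hinf h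
      exact ⟨w, fun h1 => by omega, fun _ => hw, fun _ => h0⟩
  choose w hw1 hwmem hw2 using hw
  have hwy : w 1 = y := hw1 1 rfl
  have hcoeff : ∀ i j, ∀ u, ∃ r : F, 1 ≤ i → 1 ≤ j → u ∈ 𝒜 j → ⁅w i, u⁆ = r • w (i + j) := by
    intro i j u
    by_cases h : 1 ≤ i ∧ 1 ≤ j ∧ u ∈ 𝒜 j
    · obtain ⟨r, hr⟩ := (hw2 (i + j) (by omega)).2 _ (hL.lie_mem i j _ (hwmem i h.1) u h.2.2)
      exact ⟨r, fun _ _ _ => hr⟩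
    · exact ⟨0, fun h1 h2 h3 => absurd ⟨h1, h2, h3⟩ h⟩
  choose a ha using fun i => hcoeff i 1 x
  choose e he using fun i j => hcoeff i j (w j)
  replace ha : ∀ i, 1 ≤ i → ⁅w i, x⁆ = a i • w (i + 1) := fun i hi => ha i hi le_rfl hx
  replace he : ∀ i j, 1 ≤ i → 1 ≤ j → ⁅w i, w j⁆ = e i j • w (i + j) :=
    fun i j hi hj => he i j hi hj (hwmem j hj)
  have hb : ∀ i, 1 ≤ i → ⁅w i, y⁆ = e i 1 • w (i + 1) := fun i hi => hwy ▸ he i 1 hi le_rfl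
  have hcancel : ∀ i, 2 ≤ i → ∀ r s : F, r • w i = s • w i → r = s :=
    fun i hi r s h => smul_left_injective F (hw2 i hi).1 h
  have hlie : ∀ u v z : L, ⁅⁅u, v⁆, z⁆ = ⁅⁅u, z⁆, v⁆ + ⁅u, ⁅v, z⁆⁆ := by
    intro u v z
    rw [leibniz_lie u v z, ← lie_skew ⁅u, z⁆ v]; abel
  have hskew : ∀ i j, 1 ≤ i → 1 ≤ j → e i j = -e j i := by
    intro i j hi hj
    refine hcancel (i + j) (by omega) _ _ ?_
    rw [← he i j hi hj, neg_smul, add_comm i j, ← he j i hj hi, lie_skew]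
  have hder : ∀ (z : L) (d : ℕ → F), (∀ i, 1 ≤ i → ⁅w i, z⁆ = d i • w (i + 1)) →
      ∀ i j, 1 ≤ i → 1 ≤ j → e i j * d (i + j) = d i * e (i + 1) j + d j * e i (j + 1) := by
    intro z d hd i j hi hj
    refine hcancel (i + j + 1) (by omega) _ _ ?_
    have h := hlie (w i) (w j) z
    rw [he i j hi hj, hd i hi, hd j hj, smul_lie, smul_lie, lie_smul, hd (i + j) (by omega),
      he (i + 1) j (by omega) hj, he i (j + 1) hi (by omega), show i + 1 + j = i + j + 1 by ring,
      ← add_assoc, smul_smul, smul_smul, smul_smul, ← add_smul] at h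
    exact h
  have hjac : ∀ i j k, 1 ≤ i → 1 ≤ j → 1 ≤ k →
      e i j * e (i + j) k + e j k * e (j + k) i + e k i * e (k + i) j = 0 := by
    intro i j k hi hj hk
    refine hcancel (i + j + k) (by omega) _ _ ?_
    have h : ⁅⁅w i, w j⁆, w k⁆ + ⁅⁅w j, w k⁆, w i⁆ + ⁅⁅w k, w i⁆, w j⁆ = 0 := by
      rw [hlie (w i), ← lie_skew (w i) ⁅w j, w k⁆, ← lie_skew (w i) (w k), neg_lie]; abel
    rw [he i j hi hj, he j k hj hk, he k i hk hi, smul_lie, smul_lie, smul_lie,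
      he (i + j) k (by omega) hk, he (j + k) i (by omega) hi, he (k + i) j (by omega) hj,
      show j + k + i = i + j + k by ring, show k + i + j = i + j + k by ring, smul_smul, smul_smul,
      smul_smul, ← add_smul, ← add_smul] at h
    rw [h, zero_smul]
  have hpair : ∀ i, 1 ≤ i → ∀ r s : F, ⁅w i, r • x + s • y⁆ = (r * a i + s * e i 1) • w (i + 1) := by
    intro i hi r s
    rw [lie_add, lie_smul, lie_smul, ha i hi, hb i hi, smul_smul, smul_smul, add_smul]
  have hab : ∀ i, 1 ≤ i → a i ≠ 0 ∨ e i 1 ≠ 0 := by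
    intro i hi
    by_contra! h
    apply hL.component_ne_bot hinf (i := i + 1) (by omega)
    rw [hL.component_succ_eq_span hi, eq_bot_iff, Submodule.span_le]
    rintro _ ⟨u, hu, v, hv, rfl⟩
    have hzero : ∀ v ∈ 𝒜 1, ⁅w i, v⁆ = 0 := by
      intro v hv
      obtain ⟨r, s, rfl⟩ := hxy v hv
      rw [hpair i hi, h.1, h.2]; simp
    change ⁅u, v⁆ = 0
    -- Degree one is separate because `w 1 = y` does not span `𝒜 1`; there `⁅y, x⁆ = 0` makes all of
    -- `𝒜 1` commute.
    rcases hi.eq_or_lt with rfl | hi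
    · have hyx := hzero x hx
      rw [hwy] at hyx
      obtain ⟨r, s, rfl⟩ := hxy u hu
      obtain ⟨r', s', rfl⟩ := hxy v hv
      have hxy' : ⁅x, y⁆ = 0 := by rw [← lie_skew, hyx, neg_zero]
      simp [hyx, hxy']
    · obtain ⟨r, rfl⟩ := (hw2 i hi).2 u hu
      rw [smul_lie, hzero v hv, smul_zero]
  have hmem : ∀ i, 2 ≤ i → ∀ r s : F,
      r • x + s • y ∈ twoStepCentralizer 𝒜 i ↔ r * a i + s * e i 1 = 0 := by
    intro i hi r s
    constructor
    · intro h
      have := h.2 (w i) (hwmem i (by omega))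
      rw [hpair i (by omega)] at this
      exact (smul_eq_zero.mp this).resolve_right (hw2 (i + 1) (by omega)).1
    · intro h
      refine ⟨Submodule.add_mem _ (Submodule.smul_mem _ r hx) (Submodule.smul_mem _ s hy),
        fun v hv => ?_⟩
      obtain ⟨t, rfl⟩ := (hw2 i hi).2 v hv
      rw [smul_lie, hpair i (by omega), h, zero_smul, smul_zero]
  refine ⟨genericTable a (fun i => e i 1) e,
    isBracketTable_genericTable hskew (hder x a ha) (hder y _ hb) hjac hab,
    isSeparated_genericTable (fun _ _ => rfl) hab, fun i j hi hj => ?_⟩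
  rw [genericTable_apply_one_eq_iff (fun _ _ => rfl) hab (by omega) (by omega)]
  constructor
  · intro h
    -- The vector `b_i x - a_i y`, with `b_i = e i 1`, lies in the `i`-th centralizer.
    have h1 := (hmem i hi (e i 1) (-a i)).mpr (by ring)
    rw [h, hmem j hj] at h1
    linear_combination h1
  · intro h
    have key : ∀ i j, 2 ≤ i → 2 ≤ j → e i 1 * a j = e j 1 * a i →
        twoStepCentralizer 𝒜 i ≤ twoStepCentralizer 𝒜 j := by
      intro i j hi hj h u hu
      obtain ⟨r, s, rfl⟩ := hxy u hu.1
      rw [hmem i hi] at hu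
      rw [hmem j hj]
      rcases hab i (by omega) with h0 | h0
      · refine (mul_eq_zero.mp (?_ : a i * _ = 0)).resolve_left h0
        linear_combination a j * hu - s * h
      · refine (mul_eq_zero.mp (?_ : e i 1 * _ = 0)).resolve_left h0
        linear_combination e j 1 * hu + r * h
    exact le_antisymm (key i j hi hj h) (key j i hj hi h.symm)

end IsAlgebraOfMaximalClass

end MaximalClass

theorem mainTheorem9 {p : ℕ} (hp : p.Prime) (hodd : p ≠ 2)
    {F L : Type*} [Field F] [CharP F p] [LieRing L] [LieAlgebra F L]
    (𝒜 : ℕ → Submodule F L) (hL : IsAlgebraOfMaximalClass F 𝒜)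
    (hinf : ¬ FiniteDimensional F L)
    (i : ℕ) (D : Submodule F L) (hD : IsNthTwoStepCentralizer 𝒜 i D) :
    ∃ n : ℕ, (i : ℤ) - 1 ≤ n ∧ FirstOccursAt 𝒜 D (2 * p ^ n) := by
  obtain ⟨m, ⟨hm, rfl, hfirst⟩, rfl⟩ := hD
  obtain ⟨c, hc, hs, hiff⟩ := hL.exists_bracketTable hinf
  have : CharP (RatFunc F) p := charP_of_injective_algebraMap (algebraMap F (RatFunc F)).injective p
  obtain ⟨n, rfl, hcard⟩ := IsBracketTable.exists_eq_two_mul_prime_pow hp hodd m c hc hs hm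
    fun j hj hjm h => hfirst j hj hjm ((hiff j m hj hm).mpr h)
  refine ⟨n, ?_, hm, rfl, hfirst⟩
  have hle : (twoStepCentralizer 𝒜 '' Set.Icc 2 (2 * p ^ n)).ncard ≤
      ((fun j => c j 1) '' Set.Icc 2 (2 * p ^ n)).ncard := by
    -- Each subspace is sent to the table value at a chosen weight where it occurs; equal values
    -- force equal subspaces.
    refine Set.ncard_le_ncard_of_injOn
      (fun E => c (Function.invFunOn (twoStepCentralizer 𝒜) (Set.Icc 2 (2 * p ^ n)) E) 1) ?_ ?_
      ((Set.finite_Icc _ _).image _)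
    · intro E hE
      exact ⟨_, Function.invFunOn_mem hE, rfl⟩
    · intro E hE E' hE' h
      rw [← Function.invFunOn_eq hE, ← Function.invFunOn_eq hE']
      exact (hiff _ _ (Function.invFunOn_mem hE).1 (Function.invFunOn_mem hE').1).mpr h
  omega
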